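/- Let $G$ be a finite simple undirected graph on $n$ vertices that is $3$-connected, that is, $n \ge 4$ and $G$ remains connected after the deletion of any set of at most two vertices. Then $$rc(G) \le \frac{3(n+1)}{5}.$$ Here the rainbow connection number $rc(G)$ of a connected graph $G$ is the smallest number of colours with which the edges of $G$ can be coloured (adjacent edges may receive the same colour) so that any two vertices of $G$ are joined by a path whose edges have pairwise distinct colours. -/

import Mathlib

/-- `G` is `k`-connected: it has more than `k` vertices, and it stays connected after the deletion
of any set of fewer than `k` vertices. -/
def SimpleGraph.IsVertexConnected {V : Type*} [Fintype V] (G : SimpleGraph V) (k : ℕ) : Prop :=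
  k < Fintype.card V ∧
    ∀ S : Finset V, S.card < k → (G.induce ((S : Set V)ᶜ)).Connected

/-- An edge colouring `c` of `G` makes `G` rainbow connected: any two vertices are joined by a path
whose edges have pairwise distinct colours. -/
def SimpleGraph.IsRainbowConnected {V K : Type*} (G : SimpleGraph V) (c : G.EdgeLabeling K) : Prop :=
  ∀ u v : V, ∃ p : G.Walk u v, p.IsPath ∧
    Set.InjOn c {e : G.edgeSet | (e : Sym2 V) ∈ p.edges}

/-- The rainbow connection number: the least number of colours with which the edges of `G` can be
coloured so that `G` is rainbow connected. (It is meant for connected graphs only.) -/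
noncomputable def SimpleGraph.rainbowConnectionNumber {V : Type*} (G : SimpleGraph V) : ℕ :=
  sInf {k : ℕ | ∃ c : G.EdgeLabeling (Fin k), G.IsRainbowConnected c}

/-- In a finite connected graph the rainbow connection number is attained by a colouring, so that
it is never the default value of the infimum of an empty set. -/
theorem SimpleGraph.exists_isRainbowConnected {V : Type*} [Fintype V] {G : SimpleGraph V}
    (hG : G.Connected) :
    ∃ c : G.EdgeLabeling (Fin G.rainbowConnectionNumber), G.IsRainbowConnected c := by
  classical
  have hne : {k : ℕ | ∃ c : G.EdgeLabeling (Fin k), G.IsRainbowConnected c}.Nonempty := by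
    refine ⟨Fintype.card G.edgeSet, fun e => Fintype.equivFin G.edgeSet e, fun u v => ?_⟩
    obtain ⟨p, hp⟩ := (hG.preconnected u v).exists_isPath
    exact ⟨p, hp, (Fintype.equivFin G.edgeSet).injective.injOn⟩
  exact Nat.sInf_mem hne

/-- A `k`-connected graph with `k ≥ 1` is connected. -/
theorem SimpleGraph.IsVertexConnected.connected {V : Type*} [Fintype V] {G : SimpleGraph V} {k : ℕ}
    (hk : 1 ≤ k) (h : G.IsVertexConnected k) : G.Connected := by
  have h0 := h.2 ∅ (Nat.lt_of_lt_of_le Nat.zero_lt_one hk)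
  rw [Finset.coe_empty, Set.compl_empty] at h0
  exact (SimpleGraph.induceUnivIso G).connected_iff.mp h0

/-! Grow a rainbow connected vertex set `S`, keeping `5k + 1 ≤ 3|S|` for its number `k` of colours.
An ear of length `2t + d` with `d ≤ 1` brings `2t + d - 1` vertices for `t` new colours, which
preserves the invariant unless the length is 2 or 4.

If only such short ears remain, let `C` be a component of the complement of `S` with an edge. By
3-connectivity no two vertices cover the edges between `C` and `S`, so a König argument gives three
disjoint ones, `uᵢaᵢ`. Any path outside `S` between two of the `uᵢ` has length 2, as it extends to
an ear; hence the `uᵢ` share a neighbour `w`. The resulting spider brings four vertices for two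
colours, and the growth continues.

Otherwise the complement of `S` is independent, each missing vertex has two neighbours in `S`, and
two last colours finish; with at least two vertices missing, `5(k + 2) ≤ 3|S| + 9 ≤ 3n + 3`. A
single missing vertex costs only one colour. The growth starts from a cycle, or from a 5-cycle with
a pendant edge. -/

open Finset

namespace SimpleGraph

variable {V : Type*} {G : SimpleGraph V}

/-! ### Rainbow walks inside a vertex set -/

/-- `u` and `v` are joined by a walk inside `S` whose edges have pairwise distinct colours, all of
them satisfying `P`. -/
def RainbowJoined (G : SimpleGraph V) (c : Sym2 V → ℕ) (S : Finset V) (P : ℕ → Prop) (u v : V) :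
    Prop :=
  ∃ p : G.Walk u v, (∀ x ∈ p.support, x ∈ S) ∧ (p.edges.map c).Nodup ∧ ∀ e ∈ p.edges, P (c e)

namespace RainbowJoined

variable {c : Sym2 V → ℕ} {S : Finset V} {P Q : ℕ → Prop} {u v w : V}

theorem refl (hu : u ∈ S) : G.RainbowJoined c S P u u :=
  ⟨.nil, by simpa using hu, by simp, by simp⟩

theorem edge (h : G.Adj u v) (hu : u ∈ S) (hv : v ∈ S) (hP : P (c s(u, v))) :
    G.RainbowJoined c S P u v :=
  ⟨.cons h .nil, by simp [hu, hv], by simp, by simpa using hP⟩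

theorem symm (h : G.RainbowJoined c S P u v) : G.RainbowJoined c S P v u := by
  obtain ⟨p, h1, h2, h3⟩ := h
  exact ⟨p.reverse, by simpa using h1, by simpa using h2, by simpa using h3⟩

theorem mono (h : G.RainbowJoined c S P u v) (hPQ : ∀ i, P i → Q i) :
    G.RainbowJoined c S Q u v := by
  obtain ⟨p, h1, h2, h3⟩ := h
  exact ⟨p, h1, h2, fun e he => hPQ _ (h3 e he)⟩

theorem trans (h : G.RainbowJoined c S P u v) (h' : G.RainbowJoined c S Q v w)
    (hPQ : ∀ i, P i → ¬ Q i) : G.RainbowJoined c S (fun i => P i ∨ Q i) u w := by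
  obtain ⟨p, h1, h2, h3⟩ := h
  obtain ⟨q, k1, k2, k3⟩ := h'
  refine ⟨p.append q, fun x hx => ?_, ?_, fun e he => ?_⟩
  · rcases Walk.mem_support_append_iff .. |>.1 hx with hx | hx
    exacts [h1 x hx, k1 x hx]
  · rw [Walk.edges_append, List.map_append, List.nodup_append]
    refine ⟨h2, k2, ?_⟩
    intro a ha b hb hab
    obtain ⟨e, he, rfl⟩ := List.mem_map.1 ha
    obtain ⟨f, hf, rfl⟩ := List.mem_map.1 hb
    exact hPQ _ (h3 e he) (hab ▸ k3 f hf)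
  · rw [Walk.edges_append, List.mem_append] at he
    exact he.imp (h3 e) (k3 e)

/-- A walk inside `S` uses only pairs from `S`, so recolouring all other pairs is harmless. -/
theorem extend {c' : Sym2 V → ℕ} {S' : Finset V} (h : G.RainbowJoined c S P u v) (hS : S ⊆ S')
    (hc : ∀ x ∈ S, ∀ y ∈ S, c' s(x, y) = c s(x, y)) : G.RainbowJoined c' S' P u v := by
  obtain ⟨p, h1, h2, h3⟩ := h
  have key : ∀ e ∈ p.edges, c' e = c e := by
    intro e he
    induction e with
    | _ x y => exact hc x (h1 x (p.fst_mem_support_of_mem_edges he)) y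
                (h1 y (p.snd_mem_support_of_mem_edges he))
  exact ⟨p, fun x hx => hS (h1 x hx), by rwa [List.map_congr_left key],
    fun e he => key e he ▸ h3 e he⟩

/-- A stretch of a path given by a sequence of vertices, coloured injectively. -/
theorem segment {v : ℕ → V} {g : ℕ → ℕ} {i j : ℕ} (hij : i ≤ j)
    (hadj : ∀ m, i ≤ m → m < j → G.Adj (v m) (v (m + 1)))
    (hS : ∀ m, i ≤ m → m ≤ j → v m ∈ S)
    (hc : ∀ m, i ≤ m → m < j → c s(v m, v (m + 1)) = g m)
    (hg : ∀ m m', i ≤ m → m < m' → m' < j → g m ≠ g m') :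
    G.RainbowJoined c S (fun x => ∃ m, i ≤ m ∧ m < j ∧ g m = x) (v i) (v j) := by
  induction j, hij using Nat.le_induction with
  | base => exact refl (hS i le_rfl le_rfl)
  | succ j hij ih =>
    have h1 := ih (fun m h h' => hadj m h (by omega)) (fun m h h' => hS m h (by omega))
      (fun m h h' => hc m h (by omega)) (fun m m' h h' h'' => hg m m' h h' (by omega))
    have h2 : G.RainbowJoined c S (fun x => x = g j) (v j) (v (j + 1)) :=
      edge (hadj j hij (by omega)) (hS j hij (by omega)) (hS _ (by omega) le_rfl)
        (hc j hij (by omega))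
    refine (h1.trans h2 ?_).mono ?_
    · rintro x ⟨m, hm, hm', rfl⟩ h
      exact hg m j hm hm' (by omega) h
    · rintro x (⟨m, hm, hm', rfl⟩ | rfl)
      exacts [⟨m, hm, by omega, rfl⟩, ⟨j, hij, by omega, rfl⟩]

end RainbowJoined

/-! ### Enlarging a rainbow connected set, and the cost in colours -/

/-- Any two vertices of `S` are joined inside `S` by a rainbow walk with colours below `k`. -/
def RainbowOn (G : SimpleGraph V) (c : Sym2 V → ℕ) (S : Finset V) (k : ℕ) : Prop :=
  ∀ u ∈ S, ∀ v ∈ S, G.RainbowJoined c S (· < k) u v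

theorem RainbowOn.rainbowConnectionNumber_le [Fintype V] {c : Sym2 V → ℕ} {k : ℕ} (hk : 1 ≤ k)
    (h : G.RainbowOn c univ k) : G.rainbowConnectionNumber ≤ k := by
  classical
  -- Colours from `k` on never occur on the walks used, so collapsing them to 0 is harmless.
  refine Nat.sInf_le ⟨fun e => if he : c e < k then ⟨c e, he⟩ else ⟨0, hk⟩, fun u v => ?_⟩
  obtain ⟨p, -, h2, h3⟩ := h u (mem_univ u) v (mem_univ v)
  refine ⟨p.bypass, p.bypass_isPath, ?_⟩
  rintro ⟨e, he⟩ hep ⟨f, hf⟩ hfp hef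
  have hep' := p.edges_bypass_subset_edges hep
  have hfp' := p.edges_bypass_subset_edges hfp
  simp only [h3 e hep', h3 f hfp', dif_pos, Fin.mk.injEq] at hef
  exact Subtype.ext (List.inj_on_of_nodup_map h2 hep' hfp' hef)

/-- Adding an ear of length `2 * t + d` with `d ≤ 1` to a rainbow connected set costs `t` colours. -/
theorem RainbowOn.exists_ear {c : Sym2 V → ℕ} {S : Finset V} {k : ℕ} (h : G.RainbowOn c S k)
    (hk : 1 ≤ k) {v : ℕ → V} {t d : ℕ} (hd : d ≤ 1) (ht : 1 ≤ t)
    (hinj : Set.InjOn v (Set.Iic (2 * t + d)))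
    (hadj : ∀ i < 2 * t + d, G.Adj (v i) (v (i + 1)))
    (h0 : v 0 ∈ S) (hL : v (2 * t + d) ∈ S)
    (hint : ∀ i, 0 < i → i < 2 * t + d → v i ∉ S) :
    ∃ (S' : Finset V) (c' : Sym2 V → ℕ), S'.card = S.card + (2 * t + d - 1) ∧
      G.RainbowOn c' S' (k + t) := by
  classical
  -- The new colours run in the same order along the first and the last `t` edges; a middle edge, if
  -- `d = 1`, reuses the old colour 0. So any `t + d` consecutive edges have distinct colours.
  let g : ℕ → ℕ := fun i => if i < t then k + i else if i < t + d then 0 else k + (i - t - d)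
  let E : ℕ → Sym2 V := fun i => s(v i, v (i + 1))
  let c' : Sym2 V → ℕ := fun e =>
    if he : ∃ i < 2 * t + d, e = s(v i, v (i + 1)) then g he.choose else c e
  have hv : ∀ i j, i ≤ 2 * t + d → j ≤ 2 * t + d → v i = v j → i = j :=
    fun i j hi hj hij => hinj hi hj hij
  have hc'g : ∀ i < 2 * t + d, c' s(v i, v (i + 1)) = g i := by
    intro i hi
    have he : ∃ j < 2 * t + d, s(v i, v (i + 1)) = s(v j, v (j + 1)) := ⟨i, hi, rfl⟩
    have h1 := he.choose_spec
    simp only [c', dif_pos he]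
    congr 1
    rcases Sym2.eq_iff.1 h1.2 with ⟨h2, h3⟩ | ⟨h2, h3⟩
    · exact (hv _ _ (by omega) (by omega) h2).symm
    · have := hv _ _ (by omega) (by omega) h2
      have := hv _ _ (by omega) (by omega) h3
      omega
  have hc'S : ∀ x ∈ S, ∀ y ∈ S, c' s(x, y) = c s(x, y) := by
    intro x hx y hy
    refine dif_neg ?_
    rintro ⟨i, hi, he⟩
    have : v i ∈ S ∧ v (i + 1) ∈ S := by
      rcases Sym2.eq_iff.1 he with ⟨rfl, rfl⟩ | ⟨rfl, rfl⟩
      exacts [⟨hx, hy⟩, ⟨hy, hx⟩]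
    -- The ear has length at least 2, so each of its edges has an end outside `S`.
    by_cases hi0 : i = 0
    · exact hint (i + 1) (by omega) (by omega) this.2
    · exact hint i (by omega) hi this.1
  let S' := S ∪ (Finset.Ioo 0 (2 * t + d)).image v
  have hSS' : S ⊆ S' := subset_union_left
  have hvS' : ∀ i ≤ 2 * t + d, v i ∈ S' := by
    intro i hi
    by_cases hi0 : i = 0
    · exact hSS' (hi0 ▸ h0)
    by_cases hi1 : i = 2 * t + d
    · exact hSS' (hi1 ▸ hL)
    · exact mem_union_right _ (mem_image_of_mem _ (Finset.mem_Ioo.2 ⟨by omega, by omega⟩))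
  have hS'cases : ∀ x ∈ S', x ∈ S ∨ ∃ i ≤ 2 * t + d, v i = x := by
    intro x hx
    rcases Finset.mem_union.1 hx with hx | hx
    · exact .inl hx
    · obtain ⟨i, hi, rfl⟩ := mem_image.1 hx
      exact .inr ⟨i, (Finset.mem_Ioo.1 hi).2.le, rfl⟩
  refine ⟨S', c', ?_, ?_⟩
  · rw [card_union_of_disjoint, card_image_of_injOn, Nat.card_Ioo]
    · omega
    · intro i hi j hj
      simp only [coe_Ioo, Set.mem_Ioo] at hi hj
      exact hv i j hi.2.le hj.2.le
    · rw [Finset.disjoint_right]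
      intro x hx
      obtain ⟨i, hi, rfl⟩ := mem_image.1 hx
      exact hint i (Finset.mem_Ioo.1 hi).1 (Finset.mem_Ioo.1 hi).2
  have hold : ∀ x ∈ S, ∀ y ∈ S, G.RainbowJoined c' S' (· < k) x y :=
    fun x hx y hy => (h x hx y hy).extend hSS' hc'S
  have hseg : ∀ i j, i ≤ j → j ≤ 2 * t + d → j ≤ i + t + d →
      G.RainbowJoined c' S' (fun x => ∃ m, i ≤ m ∧ m < j ∧ g m = x) (v i) (v j) := by
    intro i j hij hj hd'
    refine RainbowJoined.segment hij (fun m h1 h2 => hadj m (by omega))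
      (fun m h1 h2 => hvS' m (by omega)) (fun m h1 h2 => hc'g m (by omega)) ?_
    intro m m' h1 h2 h3
    simp only [g]
    split_ifs <;> omega
  have hfirst : ∀ j ≤ t, G.RainbowJoined c' S' (fun x => k ≤ x ∧ x < k + j) (v 0) (v j) := by
    intro j hj
    refine (hseg 0 j (by omega) (by omega) (by omega)).mono ?_
    rintro x ⟨m, h1, h2, rfl⟩
    simp only [g]
    split_ifs <;> omega
  have hlast : ∀ j, t + d ≤ j → j ≤ 2 * t + d →
      G.RainbowJoined c' S' (fun x => k + (j - t - d) ≤ x ∧ x < k + t) (v j) (v (2 * t + d)) := by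
    intro j hj hj'
    refine (hseg j _ (by omega) (by omega) (by omega)).mono ?_
    rintro x ⟨m, h1, h2, rfl⟩
    simp only [g]
    split_ifs <;> omega
  -- The ear is entered from the end that avoids the middle edge, since the old walk may use colour
  -- 0.
  have hSv : ∀ x ∈ S, ∀ j ≤ 2 * t + d, G.RainbowJoined c' S' (· < k + t) x (v j) := by
    intro x hx j hj
    by_cases hjt : j ≤ t
    · exact ((hold x hx _ h0).trans (hfirst j hjt) (by intro i; omega)).mono (by intro i; omega)
    · exact ((hold x hx _ hL).trans (hlast j (by omega) hj).symm
        (by intro i; omega)).mono (by intro i; omega)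
  have hvv : ∀ i j, i ≤ j → j ≤ 2 * t + d → G.RainbowJoined c' S' (· < k + t) (v i) (v j) := by
    intro i j hij hj
    by_cases hd' : j ≤ i + t + d
    · refine (hseg i j hij hj hd').mono ?_
      rintro x ⟨m, h1, h2, rfl⟩
      simp only [g]
      split_ifs <;> omega
    -- For distant vertices the walk goes round through `S`: one end uses new colours below `k + i`,
    -- the other those from `k + (j - t - d) > k + i` on.
    · have h1 := (hfirst i (by omega)).symm.trans (hold _ h0 _ hL) (by intro i; omega)
      exact (h1.trans (hlast j (by omega) hj).symm (by intro i; omega)).mono (by intro i; omega)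
  intro x hx y hy
  rcases hS'cases x hx with hx | ⟨i, hi, rfl⟩ <;> rcases hS'cases y hy with hy | ⟨j, hj, rfl⟩
  · exact (hold x hx y hy).mono (by intro i; omega)
  · exact hSv x hx j hj
  · exact (hSv y hy i hi).symm
  · rcases le_total i j with hij | hij
    · exact hvv i j hij hj
    · exact (hvv j i hij hi).symm

/-- A walk version of `RainbowOn.exists_ear`. -/
theorem RainbowOn.exists_ear_walk {c : Sym2 V → ℕ} {S : Finset V} {k : ℕ} (h : G.RainbowOn c S k)
    (hk : 1 ≤ k) {a b : V} (p : G.Walk a b) (hp : p.IsPath) (ha : a ∈ S) (hb : b ∈ S)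
    {t d : ℕ} (hd : d ≤ 1) (ht : 1 ≤ t) (hl : p.length = 2 * t + d)
    (hint : ∀ i, 0 < i → i < p.length → p.getVert i ∉ S) :
    ∃ (S' : Finset V) (c' : Sym2 V → ℕ), S'.card = S.card + (p.length - 1) ∧
      G.RainbowOn c' S' (k + t) := by
  rw [hl]
  exact h.exists_ear hk (v := p.getVert) hd ht
    (hl ▸ hp.getVert_injOn) (fun i hi => p.adj_getVert_succ (hl ▸ hi)) (by simpa using ha)
    (by rw [← hl, p.getVert_length]; exact hb) (hl ▸ hint)

/-- A three-legged spider attached to a rainbow connected set adds four vertices and costs two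
colours. -/
theorem RainbowOn.exists_spider {c : Sym2 V → ℕ} {S : Finset V} {k : ℕ} (h : G.RainbowOn c S k)
    {w u₁ u₂ u₃ a₁ a₂ a₃ : V} (hw : w ∉ S) (hu₁ : u₁ ∉ S) (hu₂ : u₂ ∉ S) (hu₃ : u₃ ∉ S)
    (ha₁ : a₁ ∈ S) (ha₂ : a₂ ∈ S) (ha₃ : a₃ ∈ S) (h₁₂ : u₁ ≠ u₂) (h₁₃ : u₁ ≠ u₃) (h₂₃ : u₂ ≠ u₃)
    (hw₁ : G.Adj w u₁) (hw₂ : G.Adj w u₂) (hw₃ : G.Adj w u₃)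
    (he₁ : G.Adj u₁ a₁) (he₂ : G.Adj u₂ a₂) (he₃ : G.Adj u₃ a₃) :
    ∃ (S' : Finset V) (c' : Sym2 V → ℕ), S'.card = S.card + 4 ∧ G.RainbowOn c' S' (k + 2) := by
  classical
  -- Leg 1 has `k + 1` at `w` and `k` at `S`; leg 2 has `k + 1` twice, leg 3 has `k` twice. So `u₁`
  -- and `u₃` are joined through `w`, and `u₂` is joined to either through `S`.
  let c' : Sym2 V → ℕ := fun e => if u₁ ∈ e then if w ∈ e then k + 1 else k
    else if u₂ ∈ e then k + 1 else if u₃ ∈ e then k else c e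
  have hS : ∀ x ∈ S, x ≠ w ∧ x ≠ u₁ ∧ x ≠ u₂ ∧ x ≠ u₃ := by
    intro x hx
    refine ⟨?_, ?_, ?_, ?_⟩ <;> rintro rfl <;> contradiction
  have n1 := hS _ ha₁
  have n2 := hS _ ha₂
  have n3 := hS _ ha₃
  have hc₁ : c' s(u₁, a₁) = k := by simp [c', hw₁.ne, n1.1.symm]
  have hc₂ : c' s(u₂, a₂) = k + 1 := by simp [c', h₁₂, n2.2.1.symm]
  have hc₃ : c' s(u₃, a₃) = k := by simp [c', h₁₃, h₂₃, n3.2.1.symm, n3.2.2.1.symm]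
  have hd₁ : c' s(w, u₁) = k + 1 := by simp [c']
  have hd₂ : c' s(w, u₂) = k + 1 := by simp [c', hw₁.ne']
  have hd₃ : c' s(w, u₃) = k := by simp [c', hw₁.ne', h₁₃, h₂₃, hw₂.ne']
  let S' := insert w (insert u₁ (insert u₂ (insert u₃ S)))
  have hSS' : S ⊆ S' := fun x hx => by simp [S', hx]
  have mw : w ∈ S' := by simp [S']
  have m1 : u₁ ∈ S' := by simp [S']
  have m2 : u₂ ∈ S' := by simp [S']
  have m3 : u₃ ∈ S' := by simp [S']
  have hold : ∀ x ∈ S, ∀ y ∈ S, G.RainbowJoined c' S' (· < k) x y := by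
    refine fun x hx y hy => (h x hx y hy).extend hSS' ?_
    intro x hx y hy
    simp [c', (hS x hx).2.1.symm, (hS x hx).2.2.1.symm, (hS x hx).2.2.2.symm,
      (hS y hy).2.1.symm, (hS y hy).2.2.1.symm, (hS y hy).2.2.2.symm]
  have e1 : G.RainbowJoined c' S' (· = k) u₁ a₁ := .edge he₁ m1 (hSS' ha₁) hc₁
  have e2 : G.RainbowJoined c' S' (· = k + 1) u₂ a₂ := .edge he₂ m2 (hSS' ha₂) hc₂
  have e3 : G.RainbowJoined c' S' (· = k) u₃ a₃ := .edge he₃ m3 (hSS' ha₃) hc₃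
  have f1 : G.RainbowJoined c' S' (· = k + 1) w u₁ := .edge hw₁ mw m1 hd₁
  have f2 : G.RainbowJoined c' S' (· = k + 1) w u₂ := .edge hw₂ mw m2 hd₂
  have f3 : G.RainbowJoined c' S' (· = k) w u₃ := .edge hw₃ mw m3 hd₃
  have s1 : ∀ x ∈ S, G.RainbowJoined c' S' (· ≤ k) u₁ x := fun x hx =>
    (e1.trans (hold _ ha₁ x hx) (by intro i; omega)).mono (by intro i; omega)
  have s2 : ∀ x ∈ S, G.RainbowJoined c' S' (fun i => i < k ∨ i = k + 1) u₂ x := fun x hx =>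
    (e2.trans (hold _ ha₂ x hx) (by intro i; omega)).mono (by intro i; omega)
  have s3 : ∀ x ∈ S, G.RainbowJoined c' S' (· ≤ k) u₃ x := fun x hx =>
    (e3.trans (hold _ ha₃ x hx) (by intro i; omega)).mono (by intro i; omega)
  have sw : ∀ x ∈ S, G.RainbowJoined c' S' (· < k + 2) w x := fun x hx =>
    (f1.trans (s1 x hx) (by intro i; omega)).mono (by intro i; omega)
  have p12 : G.RainbowJoined c' S' (· < k + 2) u₁ u₂ :=
    ((s1 _ ha₂).trans e2.symm (by intro i; omega)).mono (by intro i; omega)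
  have p32 : G.RainbowJoined c' S' (· < k + 2) u₃ u₂ :=
    ((s3 _ ha₂).trans e2.symm (by intro i; omega)).mono (by intro i; omega)
  have p13 : G.RainbowJoined c' S' (· < k + 2) u₁ u₃ :=
    (f1.symm.trans f3 (by intro i; omega)).mono (by intro i; omega)
  replace s1 := fun x hx => (s1 x hx).mono (Q := (· < k + 2)) (by intro i; omega)
  replace s2 := fun x hx => (s2 x hx).mono (Q := (· < k + 2)) (by intro i; omega)
  replace s3 := fun x hx => (s3 x hx).mono (Q := (· < k + 2)) (by intro i; omega)
  replace f1 := f1.mono (Q := (· < k + 2)) (by intro i; omega)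
  replace f2 := f2.mono (Q := (· < k + 2)) (by intro i; omega)
  replace f3 := f3.mono (Q := (· < k + 2)) (by intro i; omega)
  refine ⟨S', c', ?_, ?_⟩
  · rw [card_insert_of_notMem, card_insert_of_notMem, card_insert_of_notMem, card_insert_of_notMem]
      <;> simp [*, hw₁.ne, hw₂.ne, hw₃.ne]
  intro x hx y hy
  simp only [S', mem_insert] at hx hy
  rcases hx with rfl | rfl | rfl | rfl | hx <;> rcases hy with rfl | rfl | rfl | rfl | hy
  · exact .refl mw
  · exact f1
  · exact f2
  · exact f3
  · exact sw _ hy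
  · exact f1.symm
  · exact .refl m1
  · exact p12
  · exact p13
  · exact s1 _ hy
  · exact f2.symm
  · exact p12.symm
  · exact .refl m2
  · exact p32.symm
  · exact s2 _ hy
  · exact f3.symm
  · exact p13.symm
  · exact p32
  · exact .refl m3
  · exact s3 _ hy
  · exact (sw _ hx).symm
  · exact (s1 _ hx).symm
  · exact (s2 _ hx).symm
  · exact (s3 _ hx).symm
  · exact (hold x hx y hy).mono (by intro i; omega)

/-- If every vertex outside a rainbow connected set has two neighbours in it, then two more colours
make the whole graph rainbow connected. -/
theorem RainbowOn.exists_univ [Fintype V] {c : Sym2 V → ℕ} {S : Finset V} {k : ℕ}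
    (h : G.RainbowOn c S k)
    (hS : ∀ v ∉ S, ∃ a ∈ S, ∃ b ∈ S, a ≠ b ∧ G.Adj v a ∧ G.Adj v b) :
    ∃ c' : Sym2 V → ℕ, G.RainbowOn c' univ (k + 2) := by
  classical
  choose! a ha b hb hab hva hvb using hS
  -- Two missing vertices are joined by leaving one through its `a`-edge, coloured `k`, and entering
  -- the other through its `b`-edge, coloured `k + 1`.
  let c' : Sym2 V → ℕ := fun e => if ∃ v ∉ S, v ∈ e ∧ a v ∈ e then k
    else if ∃ v ∉ S, v ∈ e then k + 1 else c e
  have hca : ∀ v ∉ S, c' s(v, a v) = k := fun v hv => if_pos ⟨v, hv, by simp, by simp⟩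
  have hcb : ∀ v ∉ S, c' s(v, b v) = k + 1 := by
    intro v hv
    have h1 : ¬ ∃ x ∉ S, x ∈ s(v, b v) ∧ a x ∈ s(v, b v) := by
      rintro ⟨x, hx, hxv, hax⟩
      have hbv := hb v hv
      have hav := ha v hv
      have := hab v hv
      rcases Sym2.mem_iff.1 hxv with rfl | rfl
      · rcases Sym2.mem_iff.1 hax with h | h
        · exact hx (h ▸ hav)
        · exact this h
      · exact hx hbv
    simp only [c']
    rw [if_neg h1, if_pos ⟨v, hv, by simp⟩]
  have hold : ∀ x ∈ S, ∀ y ∈ S, G.RainbowJoined c' univ (· < k) x y := by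
    refine fun x hx y hy => (h x hx y hy).extend (subset_univ _) ?_
    intro x hx y hy
    have : ∀ v ∉ S, v ∉ s(x, y) := by
      intro v hv hvxy
      rcases Sym2.mem_iff.1 hvxy with rfl | rfl <;> contradiction
    simp only [c']
    rw [if_neg (fun ⟨v, hv, h1, _⟩ => this v hv h1), if_neg (fun ⟨v, hv, h1⟩ => this v hv h1)]
  have hA : ∀ v ∉ S, ∀ x ∈ S, G.RainbowJoined c' univ (· ≤ k) v x := by
    intro v hv x hx
    have e : G.RainbowJoined c' univ (· = k) v (a v) :=
      .edge (hva v hv) (mem_univ _) (mem_univ _) (hca v hv)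
    exact (e.trans (hold _ (ha v hv) x hx) (by intro i; omega)).mono (by intro i; omega)
  refine ⟨c', fun x _ y _ => ?_⟩
  by_cases hx : x ∈ S <;> by_cases hy : y ∈ S
  · exact (hold x hx y hy).mono (by intro i; omega)
  · exact (hA y hy x hx).symm.mono (by intro i; omega)
  · exact (hA x hx y hy).mono (by intro i; omega)
  · have e : G.RainbowJoined c' univ (· = k + 1) y (b y) :=
      .edge (hvb y hy) (mem_univ _) (mem_univ _) (hcb y hy)
    exact ((hA x hx _ (hb y hy)).trans e.symm (by intro i; omega)).mono (by intro i; omega)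

/-- A five-cycle with a pendant edge is rainbow connected with three colours. -/
theorem exists_rainbowOn_cycle_pendant {v : Fin 5 → V} (hv : Function.Injective v)
    (hadj : ∀ i, G.Adj (v i) (v (i + 1))) {w : V} (hw : ∀ i, w ≠ v i) {j : Fin 5}
    (hwj : G.Adj w (v j)) :
    ∃ (S : Finset V) (c : Sym2 V → ℕ), S.card = 6 ∧ G.RainbowOn c S 3 := by
  classical
  wlog hj : j = 0 generalizing v j
  · exact this (v := fun i => v (i + j)) (hv.comp (add_left_injective j))
      (fun i => by simpa [add_right_comm] using hadj (i + j)) (fun i => hw _) (j := 0)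
      (by simpa using hwj) rfl
  subst hj
  -- Colour 0 sits on the edge opposite `v 0`, so `v 0` reaches the whole cycle with colours 1 and
  -- 2, leaving 0 for the pendant edge.
  let g : Fin 5 → ℕ := ![1, 2, 0, 1, 2]
  let c : Sym2 V → ℕ := fun e => if he : ∃ i, e = s(v i, v (i + 1)) then g he.choose else 0
  have hc : ∀ i, c s(v i, v (i + 1)) = g i := by
    intro i
    have he : ∃ j, s(v i, v (i + 1)) = s(v j, v (j + 1)) := ⟨i, rfl⟩
    have h1 := he.choose_spec
    simp only [c, dif_pos he]
    congr 1
    rcases Sym2.eq_iff.1 h1 with ⟨h2, h3⟩ | ⟨h2, h3⟩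
    · exact (hv h2).symm
    · have h4 := hv h2
      have h5 := hv h3
      have : ∀ x : Fin 5, x + 1 + 1 ≠ x := by decide
      exact absurd ((congrArg (· + 1) h4).symm.trans h5) (this _)
  have hcw : ∀ i, c s(w, v i) = 0 := by
    intro i
    refine dif_neg ?_
    rintro ⟨j, hj⟩
    rcases Sym2.eq_iff.1 hj with ⟨h2, h3⟩ | ⟨h2, h3⟩
    exacts [hw _ h2, hw _ h2]
  let S := insert w (univ.image v)
  have mv : ∀ i, v i ∈ S := fun i => by simp [S]
  have mw : w ∈ S := by simp [S]
  have e1 : ∀ i, G.RainbowJoined c S (· = g i) (v i) (v (i + 1)) := fun i =>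
    .edge (hadj i) (mv _) (mv _) (hc i)
  have e2 : ∀ i, G.RainbowJoined c S (fun x => x = g i ∨ x = g (i + 1)) (v i) (v (i + 1 + 1)) := by
    intro i
    refine (e1 i).trans (e1 (i + 1)) ?_
    rintro _ rfl
    revert i
    decide
  have hg : ∀ i, g i < 3 := by decide
  have hvv : ∀ i j, G.RainbowJoined c S (· < 3) (v i) (v j) := by
    intro i j
    have h1 : ∀ i, G.RainbowJoined c S (· < 3) (v i) (v (i + 1)) := fun i =>
      (e1 i).mono (by rintro _ rfl; exact hg i)
    have h2 : ∀ i, G.RainbowJoined c S (· < 3) (v i) (v (i + 1 + 1)) := fun i =>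
      (e2 i).mono (by rintro _ (rfl | rfl); exacts [hg i, hg _])
    have : j = i ∨ j = i + 1 ∨ j = i + 1 + 1 ∨ i = j + 1 ∨ i = j + 1 + 1 := by
      revert i j
      decide
    rcases this with rfl | rfl | rfl | rfl | rfl
    exacts [.refl (mv _), h1 _, h2 _, (h1 _).symm, (h2 _).symm]
  have h0v : ∀ i, G.RainbowJoined c S (fun x => 0 < x ∧ x < 3) (v 0) (v i) := by
    intro i
    fin_cases i
    · exact .refl (mv _)
    · exact (e1 0).mono (by simp [g])
    · exact (e2 0).mono (by simp [g])
    · exact (e2 3).symm.mono (by simp [g])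
    · exact (e1 4).symm.mono (by simp [g])
  have hwv : ∀ i, G.RainbowJoined c S (· < 3) w (v i) := by
    intro i
    have e : G.RainbowJoined c S (· = 0) w (v 0) := .edge hwj mw (mv _) (hcw 0)
    exact (e.trans (h0v i) (by intro i; omega)).mono (by intro i; omega)
  refine ⟨S, c, ?_, ?_⟩
  · rw [card_insert_of_notMem, card_image_of_injective _ hv]
    · simp
    · simpa using fun i => (hw i).symm
  · intro x hx y hy
    simp only [S, mem_insert, mem_image, mem_univ, true_and] at hx hy
    rcases hx with rfl | ⟨i, rfl⟩ <;> rcases hy with rfl | ⟨j, rfl⟩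
    exacts [.refl mw, hwv j, (hwv i).symm, hvv i j]

/-! ### Three-connectivity and short ears -/

/-- If the edges between `C` and `S` cannot be covered by two vertices, then three of them are
disjoint. -/
theorem exists_three_disjoint [Nonempty V] {S : Finset V} {C : Set V}
    (h : ∀ p q : V, ∃ u ∈ C, ∃ a ∈ S, G.Adj u a ∧ u ≠ p ∧ u ≠ q ∧ a ≠ p ∧ a ≠ q) :
    ∃ u₁ ∈ C, ∃ u₂ ∈ C, ∃ u₃ ∈ C, ∃ a₁ ∈ S, ∃ a₂ ∈ S, ∃ a₃ ∈ S, G.Adj u₁ a₁ ∧ G.Adj u₂ a₂ ∧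
      G.Adj u₃ a₃ ∧ u₁ ≠ u₂ ∧ u₁ ≠ u₃ ∧ u₂ ≠ u₃ ∧ a₁ ≠ a₂ ∧ a₁ ≠ a₃ ∧ a₂ ≠ a₃ := by
  by_contra hno
  have no : ∀ u₁ u₂ u₃ a₁ a₂ a₃, u₁ ∈ C → u₂ ∈ C → u₃ ∈ C → a₁ ∈ S → a₂ ∈ S → a₃ ∈ S →
      G.Adj u₁ a₁ → G.Adj u₂ a₂ → G.Adj u₃ a₃ → u₁ ≠ u₂ → u₁ ≠ u₃ → u₂ ≠ u₃ → a₁ ≠ a₂ → a₁ ≠ a₃ →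
      a₂ ≠ a₃ → False := fun u₁ u₂ u₃ a₁ a₂ a₃ h1 h2 h3 h4 h5 h6 h7 h8 h9 h10 h11 h12 h13 h14 h15 =>
    hno ⟨u₁, h1, u₂, h2, u₃, h3, a₁, h4, a₂, h5, a₃, h6, h7, h8, h9, h10, h11, h12, h13, h14, h15⟩
  -- Two edges at `a₂` and a third edge `u₁a₁` suffice: an edge avoiding `u₁` and `a₂` either
  -- completes the triple or is a second edge at `a₁`. In the latter case an edge avoiding `a₁` and
  -- `a₂` leaves a free choice at both.
  have key : ∀ u₁ u₂ u₃ a₁ a₂, u₁ ∈ C → u₂ ∈ C → u₃ ∈ C → a₁ ∈ S → a₂ ∈ S → G.Adj u₁ a₁ →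
      G.Adj u₂ a₂ → G.Adj u₃ a₂ → u₁ ≠ u₂ → u₁ ≠ u₃ → u₂ ≠ u₃ → a₁ ≠ a₂ → False := by
    intro u₁ u₂ u₃ a₁ a₂ m1 m2 m3 l1 l2 e1 e2 e3 n12 n13 n23 na
    obtain ⟨u₄, m4, a₄, l4, e4, p1, -, -, p4⟩ := h u₁ a₂
    by_cases hd : a₄ = a₁
    · subst hd
      obtain ⟨u₅, m5, a₅, l5, e5, -, -, q3, q4⟩ := h a₄ a₂
      by_cases h5 : u₅ = u₁
      · subst h5
        by_cases h42 : u₄ = u₂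
        · exact no u₅ u₄ u₃ a₅ a₄ a₂ m5 m4 m3 l5 l1 l2 e5 e4 e3 p1.symm n13 (h42 ▸ n23) q3 q4 na
        · exact no u₅ u₄ u₂ a₅ a₄ a₂ m5 m4 m2 l5 l1 l2 e5 e4 e2 p1.symm n12 h42 q3 q4 na
      · by_cases h52 : u₅ = u₂
        · exact no u₅ u₁ u₃ a₅ a₄ a₂ m5 m1 m3 l5 l1 l2 e5 e1 e3 h5 (h52 ▸ n23) n13 q3 q4 na
        · exact no u₅ u₁ u₂ a₅ a₄ a₂ m5 m1 m2 l5 l1 l2 e5 e1 e2 h5 h52 n12 q3 q4 na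
    · by_cases h42 : u₄ = u₂
      · exact no u₄ u₁ u₃ a₄ a₁ a₂ m4 m1 m3 l4 l1 l2 e4 e1 e3 p1 (h42 ▸ n23) n13 hd p4 na
      · exact no u₄ u₁ u₂ a₄ a₁ a₂ m4 m1 m2 l4 l1 l2 e4 e1 e2 p1 h42 n12 hd p4 na
  obtain ⟨u₁, m1, a₁, l1, e1, -⟩ := h (Classical.arbitrary V) (Classical.arbitrary V)
  obtain ⟨u₂, m2, a₂, l2, e2, p1, -, -, p4⟩ := h u₁ a₁
  obtain ⟨u₃, m3, a₃, l3, e3, q1, q2, -⟩ := h u₁ u₂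
  by_cases h1 : a₃ = a₁
  · exact key u₂ u₁ u₃ a₂ a₁ m2 m1 m3 l2 l1 e2 e1 (h1 ▸ e3) p1 q2.symm q1.symm p4
  by_cases h2 : a₃ = a₂
  · exact key u₁ u₂ u₃ a₁ a₂ m1 m2 m3 l1 l2 e1 e2 (h2 ▸ e3) p1.symm q1.symm q2.symm p4.symm
  exact no u₁ u₂ u₃ a₁ a₂ a₃ m1 m2 m3 l1 l2 l3 e1 e2 e3 p1.symm q1.symm q2.symm p4.symm
    (Ne.symm h1) (Ne.symm h2)

/-- In a 3-connected graph, the edges leaving a set of vertices are not covered by two vertices,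
unless these contain the whole set or its whole complement. -/
theorem IsVertexConnected.exists_adj_of_mem_of_notMem [Fintype V] (hG : G.IsVertexConnected 3)
    {C : Set V} {x s : V} (hx : x ∈ C) (hs : s ∉ C) (p q : V) (hxp : x ≠ p) (hxq : x ≠ q)
    (hsp : s ≠ p) (hsq : s ≠ q) :
    ∃ u ∈ C, ∃ a ∉ C, G.Adj u a ∧ u ≠ p ∧ u ≠ q ∧ a ≠ p ∧ a ≠ q := by
  classical
  have h := hG.2 {p, q} (lt_of_le_of_lt card_le_two (by norm_num))
  have hx' : x ∈ ((({p, q} : Finset V) : Set V)ᶜ) := by simp [hxp, hxq]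
  have hs' : s ∈ ((({p, q} : Finset V) : Set V)ᶜ) := by simp [hsp, hsq]
  obtain ⟨r⟩ := h.preconnected ⟨x, hx'⟩ ⟨s, hs'⟩
  obtain ⟨d, -, h1, h2⟩ := r.exists_boundary_dart (Subtype.val ⁻¹' C) hx hs
  have h3 := d.fst.2
  have h4 := d.snd.2
  simp only [coe_insert, coe_singleton, Set.mem_compl_iff, Set.mem_insert_iff,
    Set.mem_singleton_iff, not_or] at h3 h4
  exact ⟨_, h1, _, h2, d.adj, h3.1, h3.2, h4.1, h4.2⟩

/-- Every ear of `S` has length two or four. -/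
def ShortEars (G : SimpleGraph V) (S : Finset V) : Prop :=
  ∀ ⦃a b : V⦄ (p : G.Walk a b), p.IsPath → a ∈ S → b ∈ S → 2 ≤ p.length →
    (∀ i, 0 < i → i < p.length → p.getVert i ∉ S) → p.length = 2 ∨ p.length = 4

/-- Adding the edges to `a` and `b` turns `p` into an ear two longer. -/
theorem ShortEars.length_eq {S : Finset V} (h : G.ShortEars S) {x y a b : V} (p : G.Walk x y)
    (hp : p.IsPath) (hpS : ∀ z ∈ p.support, z ∉ S) (ha : a ∈ S) (hb : b ∈ S) (hab : a ≠ b)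
    (hxa : G.Adj x a) (hyb : G.Adj y b) : p.length = 0 ∨ p.length = 2 := by
  have hpa : a ∉ p.support := fun h => hpS a h ha
  have hpb : b ∉ p.support := fun h => hpS b h hb
  have hq : (Walk.cons hxa.symm (p.concat hyb)).IsPath := by
    rw [Walk.cons_isPath_iff]
    refine ⟨hp.concat hpb hyb, ?_⟩
    simp [Walk.support_concat, hpa, hab]
  have := h _ hq ha hb (by simp) ?_
  · simpa using this
  · intro i hi hi'
    obtain ⟨i, rfl⟩ : ∃ j, i = j + 1 := ⟨i - 1, by omega⟩
    rw [Walk.getVert_cons_succ, Walk.concat_eq_append, Walk.getVert_append]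
    simp only [Walk.length_cons, Walk.length_concat] at hi'
    split_ifs with h1
    · exact hpS _ (p.getVert_mem_support i)
    · obtain rfl : i = p.length := by omega
      simpa using hpS _ p.end_mem_support

/-- If all ears of `S` are short and two adjacent vertices are missed by `S`, then a three-legged
spider can be attached to `S`. -/
theorem ShortEars.exists_spider [Fintype V] (hG : G.IsVertexConnected 3) {S : Finset V}
    (h : G.ShortEars S) (hS : 3 ≤ S.card) {x y : V} (hx : x ∉ S) (hy : y ∉ S) (hxy : G.Adj x y) :
    ∃ w ∉ S, ∃ u₁ ∉ S, ∃ u₂ ∉ S, ∃ u₃ ∉ S, ∃ a₁ ∈ S, ∃ a₂ ∈ S, ∃ a₃ ∈ S, u₁ ≠ u₂ ∧ u₁ ≠ u₃ ∧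
      u₂ ≠ u₃ ∧ G.Adj w u₁ ∧ G.Adj w u₂ ∧ G.Adj w u₃ ∧ G.Adj u₁ a₁ ∧ G.Adj u₂ a₂ ∧
      G.Adj u₃ a₃ := by
  classical
  -- The component of `x` in the complement of `S`.
  let C : Set V := {z | ∃ p : G.Walk x z, ∀ t ∈ p.support, t ∉ S}
  have hCS : ∀ u ∈ C, u ∉ S := fun u ⟨p, hp⟩ => hp u p.end_mem_support
  have hC : ∀ u ∈ C, ∀ v, G.Adj u v → v ∉ S → v ∈ C := by
    rintro u ⟨p, hp⟩ v huv hv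
    refine ⟨p.concat huv, fun t ht => ?_⟩
    rw [Walk.support_concat, List.mem_append, List.mem_singleton] at ht
    rcases ht with ht | rfl
    exacts [hp t ht, hv]
  have hxC : x ∈ C := ⟨.nil, by simpa using hx⟩
  have hyC : y ∈ C := hC x hxC y hxy hy
  have hpath : ∀ u ∈ C, ∀ v ∈ C, ∃ p : G.Walk u v, p.IsPath ∧ ∀ t ∈ p.support, t ∉ S := by
    rintro u ⟨p, hp⟩ v ⟨q, hq⟩
    refine ⟨(p.reverse.append q).bypass, Walk.bypass_isPath _, fun t ht => ?_⟩
    have := Walk.support_bypass_subset_support _ ht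
    rw [Walk.mem_support_append_iff, Walk.support_reverse, List.mem_reverse] at this
    exact this.elim (hp t) (hq t)
  have hedge : ∀ p q, (∃ z ∈ C, z ≠ p ∧ z ≠ q) →
      ∃ u ∈ C, ∃ a ∈ S, G.Adj u a ∧ u ≠ p ∧ u ≠ q ∧ a ≠ p ∧ a ≠ q := by
    rintro p q ⟨z, hz, hzp, hzq⟩
    obtain ⟨s, hs, hs'⟩ : ∃ s ∈ S, s ∉ ({p, q} : Finset V) :=
      exists_mem_notMem_of_card_lt_card (lt_of_le_of_lt card_le_two (by omega))
    simp only [mem_insert, mem_singleton, not_or] at hs'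
    obtain ⟨u, hu, a, ha, hua, h'⟩ := hG.exists_adj_of_mem_of_notMem hz (fun h => hCS s h hs) p q
      hzp hzq hs'.1 hs'.2
    refine ⟨u, hu, a, ?_, hua, h'⟩
    by_contra haS
    exact ha (hC u hu a hua haS)
  have hmid : ∀ u ∈ C, ∀ v ∈ C, ∀ a ∈ S, ∀ b ∈ S, u ≠ v → a ≠ b → G.Adj u a → G.Adj v b →
      ∃ w ∈ C, G.Adj w u ∧ G.Adj w v := by
    intro u hu v hv a ha b hb huv hab hua hvb
    obtain ⟨p, hp, hpS⟩ := hpath u hu v hv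
    rcases h.length_eq p hp hpS ha hb hab hua hvb with hl | hl
    · exact absurd (Walk.eq_of_length_eq_zero hl) huv
    · have h1 := p.adj_getVert_succ (i := 0) (by omega)
      have h2 := p.adj_getVert_succ (i := 1) (by omega)
      have h3 : p.getVert 2 = v := hl ▸ p.getVert_length
      rw [p.getVert_zero] at h1
      simp only [zero_add, Nat.reduceAdd, h3] at h1 h2
      exact ⟨_, hC u hu _ h1 (hpS _ (p.getVert_mem_support 1)), h1.symm, h2⟩
  have hnadj : ∀ u ∈ C, ∀ v ∈ C, ∀ a ∈ S, ∀ b ∈ S, a ≠ b → G.Adj u a → G.Adj v b →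
      ¬ G.Adj u v := by
    intro u hu v hv a ha b hb hab hua hvb huv
    have := h.length_eq (.cons huv .nil) (by simp [huv.ne]) (by simp [hCS u hu, hCS v hv]) ha hb
      hab hua hvb
    simp at this
  -- `C` has three vertices: the ends `u₁`, `u₂` of two disjoint edges to `S`, and their common
  -- neighbour.
  have hthree : ∀ p q, ∃ z ∈ C, z ≠ p ∧ z ≠ q := by
    obtain ⟨u₁, m1, a₁, l1, e1, -⟩ : ∃ u ∈ C, ∃ a ∈ S, G.Adj u a ∧ u ≠ y ∧ u ≠ y ∧ a ≠ y ∧ a ≠ y :=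
      hedge y y ⟨x, hxC, hxy.ne, hxy.ne⟩
    obtain ⟨u₂, m2, a₂, l2, e2, p1, -, -, p4⟩ := hedge u₁ a₁ <| by
      by_cases hxu : x = u₁
      · exact ⟨y, hyC, hxu ▸ hxy.ne', fun h => hy (h ▸ l1)⟩
      · exact ⟨x, hxC, hxu, fun h => hx (h ▸ l1)⟩
    obtain ⟨w, mw, w1, w2⟩ := hmid u₁ m1 u₂ m2 a₁ l1 a₂ l2 p1.symm p4.symm e1 e2
    intro p q
    have h1 := w1.ne
    have h2 := w2.ne
    by_cases c1 : u₁ ≠ p ∧ u₁ ≠ q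
    · exact ⟨u₁, m1, c1⟩
    by_cases c2 : u₂ ≠ p ∧ u₂ ≠ q
    · exact ⟨u₂, m2, c2⟩
    refine ⟨w, mw, ?_, ?_⟩ <;> grind
  have : Nonempty V := ⟨x⟩
  obtain ⟨u₁, m1, u₂, m2, u₃, m3, a₁, l1, a₂, l2, a₃, l3, e1, e2, e3, n12, n13, n23, k12, k13, k23⟩ :=
    exists_three_disjoint fun p q => hedge p q (hthree p q)
  obtain ⟨w, mw, w1, w2⟩ := hmid u₁ m1 u₂ m2 a₁ l1 a₂ l2 n12 k12 e1 e2
  obtain ⟨z, mz, z2, z3⟩ := hmid u₂ m2 u₃ m3 a₂ l2 a₃ l3 n23 k23 e2 e3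
  -- Equality would make `u₁` and `u₃` adjacent, giving an ear of length 3.
  have w3 : w ≠ u₃ := by
    rintro rfl
    exact hnadj _ m3 _ m1 _ l3 _ l1 k13.symm e3 e1 w1
  have z1 : z ≠ u₁ := by
    rintro rfl
    exact hnadj _ m1 _ m2 _ l1 _ l2 k12 e1 e2 z2
  -- Otherwise `u₁ w u₂ z u₃` extends to an ear of length 6.
  have hwz : w = z := by
    by_contra hwz
    have := h.length_eq (.cons w1.symm (.cons w2 (.cons z2.symm (.cons z3 .nil))))
      (by simp [Walk.cons_isPath_iff, n12, n13, n23, w1.ne', w2.ne, z2.ne', z3.ne, w3, z1.symm, hwz])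
      (by simp [hCS _ m1, hCS _ m2, hCS _ m3, hCS _ mw, hCS _ mz]) l1 l3 k13 e1 e3
    simp at this
  subst hwz
  exact ⟨w, hCS _ mw, u₁, hCS _ m1, u₂, hCS _ m2, u₃, hCS _ m3, a₁, l1, a₂, l2, a₃, l3, n12, n13, n23,
    w1, w2, z3, e1, e2, e3⟩

/-! ### Growing to the whole graph, and the starting set -/

/-- A rainbow connected set with few colours extends to a rainbow colouring of a 3-connected
graph with few colours. -/
theorem RainbowOn.exists_univ_of_isVertexConnected [Fintype V] (hG : G.IsVertexConnected 3)
    {S : Finset V} {c : Sym2 V → ℕ} {k : ℕ} (h : G.RainbowOn c S k) (hk : 1 ≤ k)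
    (hkS : 5 * k + 1 ≤ 3 * S.card) (hS : 3 ≤ S.card) :
    ∃ (c' : Sym2 V → ℕ) (k' : ℕ), 1 ≤ k' ∧ 5 * k' ≤ 3 * Fintype.card V + 3 ∧
      G.RainbowOn c' univ k' := by
  classical
  induction hn : Fintype.card V - S.card using Nat.strong_induction_on generalizing S c k with
  | _ n ih =>
  subst hn
  have hlt : ∀ T : Finset V, T.card ≤ Fintype.card V := fun T => T.card_le_univ
  by_cases hears : G.ShortEars S
  swap
  · simp only [ShortEars, not_forall, not_or] at hears
    obtain ⟨a, b, p, hp, ha, hb, hl, hint, hl2, hl4⟩ := hears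
    -- The invariant survives when `5t ≤ 3(2t + d - 1)`, that is `t + 3d ≥ 3`, which fails only for
    -- lengths 2 and 4.
    obtain ⟨S', c', h3, h4⟩ := h.exists_ear_walk hk p hp ha hb (t := p.length / 2)
      (d := p.length % 2) (by omega) (by omega) (by omega) hint
    have := hlt S'
    exact ih _ (by omega) h4 (by omega) (by omega) (by omega) rfl
  by_cases hind : ∃ x ∉ S, ∃ y ∉ S, G.Adj x y
  · obtain ⟨x, hx, y, hy, hxy⟩ := hind
    obtain ⟨w, mw, u₁, m1, u₂, m2, u₃, m3, a₁, l1, a₂, l2, a₃, l3, n12, n13, n23, w1, w2, w3, e1, e2,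
      e3⟩ := hears.exists_spider hG hS hx hy hxy
    obtain ⟨S', c', h1, h2⟩ := h.exists_spider mw m1 m2 m3 l1 l2 l3 n12 n13 n23 w1 w2 w3 e1 e2 e3
    have := hlt S'
    exact ih _ (by omega) h2 (by omega) (by omega) (by omega) rfl
  have hnb : ∀ v ∉ S, ∃ a ∈ S, ∃ b ∈ S, a ≠ b ∧ G.Adj v a ∧ G.Adj v b := by
    intro v hv
    have hout : ∀ q, v ≠ q → ∃ a ∈ S, a ≠ q ∧ G.Adj v a := by
      intro q hvq
      obtain ⟨s, hs, hsq⟩ : ∃ s ∈ S, s ≠ q := exists_mem_ne (by omega) q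
      obtain ⟨u, rfl, a, -, hua, -, -, haq, -⟩ := hG.exists_adj_of_mem_of_notMem
        (C := {v}) rfl (show s ∉ ({v} : Set V) from fun h => hv (h ▸ hs)) q q hvq hvq hsq hsq
      refine ⟨a, ?_, haq, hua⟩
      by_contra ha
      exact hind ⟨_, hv, a, ha, hua⟩
    obtain ⟨s, hs⟩ : S.Nonempty := card_pos.1 (by omega)
    obtain ⟨a, ha, -, hva⟩ := hout s (fun h => hv (h ▸ hs))
    obtain ⟨b, hb, hba, hvb⟩ := hout a hva.ne
    exact ⟨a, ha, b, hb, hba.symm, hva, hvb⟩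
  have huniv : ∀ T : Finset V, Fintype.card V ≤ T.card → T = univ := fun T hT =>
    (card_eq_iff_eq_univ T).1 (le_antisymm (hlt T) hT)
  by_cases h0 : Fintype.card V ≤ S.card
  · obtain rfl := huniv S h0
    exact ⟨c, k, hk, by rw [card_univ] at hkS; omega, h⟩
  -- With one vertex missing, two more colours could exceed the bound; an ear of length 2 costs only
  -- one.
  by_cases h1 : Fintype.card V = S.card + 1
  · obtain ⟨v, hv⟩ : ∃ v, v ∉ S := by
      by_contra! hall
      rw [eq_univ_iff_forall.2 hall, card_univ] at h0
      exact h0 le_rfl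
    obtain ⟨a, ha, b, hb, hab, hva, hvb⟩ := hnb v hv
    obtain ⟨S', c', h3, h4⟩ := h.exists_ear_walk hk (.cons hva.symm (.cons hvb .nil))
      (by simp [Walk.cons_isPath_iff, hab, hva.ne', hvb.ne]) ha hb (t := 1) (d := 0) (by omega)
      le_rfl rfl (by
        intro i hi hi'
        obtain rfl : i = 1 := by simp at hi'; omega
        simpa using hv)
    simp only [Walk.length_cons, Walk.length_nil] at h3
    obtain rfl := huniv S' (by omega)
    exact ⟨c', k + 1, by omega, by omega, h4⟩
  · obtain ⟨c', h'⟩ := h.exists_univ hnb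
    exact ⟨c', k + 2, by omega, by omega, h'⟩

/-- An edge with one colour meets the invariant with equality, but the growth needs three vertices
in `S`, so that two deleted vertices leave one. An ear closing the edge to a cycle supplies them. -/
theorem IsVertexConnected.exists_rainbowOn_univ [Fintype V] (hG : G.IsVertexConnected 3) :
    ∃ (c : Sym2 V → ℕ) (k : ℕ), 1 ≤ k ∧ 5 * k ≤ 3 * Fintype.card V + 3 ∧
      G.RainbowOn c univ k := by
  classical
  have hcard := hG.1
  have hother : ∀ s : Finset V, s.card < Fintype.card V → ∃ x, x ∉ s := fun s hs => by
    obtain ⟨x, -, hx⟩ := exists_mem_notMem_of_card_lt_card (s := s) (t := univ) hs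
    exact ⟨x, hx⟩
  obtain ⟨u, -⟩ := hother ∅ (by simp; omega)
  have hnbr : ∀ q, u ≠ q → ∃ x, x ≠ q ∧ G.Adj u x := by
    intro q hq
    obtain ⟨s, hs⟩ := hother {u, q} (lt_of_le_of_lt card_le_two (by omega))
    simp only [mem_insert, mem_singleton, not_or] at hs
    obtain ⟨_, rfl, x, -, hux, -, -, hxq, -⟩ := hG.exists_adj_of_mem_of_notMem
      (C := {u}) rfl hs.1 q q hq hq hs.2 hs.2
    exact ⟨x, hxq, hux⟩
  obtain ⟨z, hz⟩ := hother {u} (by simp; omega)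
  obtain ⟨v, -, huv⟩ := hnbr z (by simpa [eq_comm] using hz)
  obtain ⟨x, hxv, hux⟩ := hnbr v huv.ne
  obtain ⟨q, hq, huq⟩ : ∃ q : G.Walk x v, q.IsPath ∧ u ∉ q.support := by
    have h := hG.2 {u} (by simp)
    have hx' : x ∈ ((({u} : Finset V) : Set V)ᶜ) := by simp [hux.ne']
    have hv' : v ∈ ((({u} : Finset V) : Set V)ᶜ) := by simp [huv.ne']
    obtain ⟨r⟩ := h.preconnected ⟨x, hx'⟩ ⟨v, hv'⟩
    have hr : ∀ {a b} (r : (G.induce ((({u} : Finset V) : Set V)ᶜ)).Walk a b),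
        u ∉ (r.map (Embedding.induce _).toHom).support := by
      intro a b r hu
      rw [Walk.support_map, List.mem_map] at hu
      obtain ⟨y, -, hy⟩ := hu
      exact y.2 (by simpa using hy)
    exact ⟨(r.map (Embedding.induce _).toHom).bypass, Walk.bypass_isPath _,
      fun hu => hr r (Walk.support_bypass_subset_support _ hu)⟩
  obtain ⟨p, hp, hpl, hp1⟩ : ∃ p : G.Walk u v, p.IsPath ∧ 2 ≤ p.length ∧ p.getVert 1 = x := by
    refine ⟨.cons hux q, (Walk.cons_isPath_iff ..).2 ⟨hq, huq⟩, ?_, by simp⟩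
    have : q.length ≠ 0 := fun h => hxv (Walk.eq_of_length_eq_zero h)
    rw [Walk.length_cons]
    omega
  have hpinj : ∀ i j, i ≤ p.length → j ≤ p.length → p.getVert i = p.getVert j → i = j :=
    fun i j hi hj h => hp.getVert_injOn hi hj h
  have hint : ∀ i, 0 < i → i < p.length → p.getVert i ∉ ({u, v} : Finset V) := by
    intro i hi hi' h
    rw [mem_insert, mem_singleton] at h
    rcases h with h | h
    · have := hpinj i 0 hi'.le (by omega) (by simpa using h)
      omega
    · have := hpinj i p.length hi'.le le_rfl (by simpa using h)
      omega
  have hedge : G.RainbowOn (fun _ => 0) {u, v} 1 := by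
    intro a ha b hb
    by_cases hab : a = b
    · exact hab ▸ .refl ha
    · refine .edge ?_ ha hb (by simp)
      simp only [mem_insert, mem_singleton] at ha hb
      rcases ha with rfl | rfl <;> rcases hb with rfl | rfl
      exacts [absurd rfl hab, huv, huv.symm, absurd rfl hab]
  have hear := fun t d hd ht hl => hedge.exists_ear_walk le_rfl p hp (by simp) (by simp) (t := t)
    (d := d) hd ht hl hint
  rw [card_pair huv.ne] at hear
  by_cases h2 : p.length = 2
  · have hxv' : G.Adj x v := by
      have := p.adj_getVert_succ (i := 1) (by omega)
      rwa [hp1, show 1 + 1 = p.length by omega, p.getVert_length] at this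
    have h3 : ({u, v, x} : Finset V).card = 3 := by
      rw [card_eq_three]
      exact ⟨u, v, x, huv.ne, hux.ne, hxv.symm, rfl⟩
    refine RainbowOn.exists_univ_of_isVertexConnected hG (S := {u, v, x}) (c := fun _ => 0) (k := 1)
      ?_ le_rfl (by omega) h3.ge
    intro a ha b hb
    by_cases hab : a = b
    · exact hab ▸ .refl ha
    · refine .edge ?_ ha hb (by simp)
      simp only [mem_insert, mem_singleton] at ha hb
      rcases ha with rfl | rfl | rfl <;> rcases hb with rfl | rfl | rfl
      exacts [absurd rfl hab, huv, hux, huv.symm, absurd rfl hab, hxv'.symm, hux.symm, hxv',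
        absurd rfl hab]
  by_cases h4 : p.length = 4
  -- A 5-cycle gets three colours and just misses the invariant, as `16 > 15`. For `n = 5` three
  -- colours are within the bound; otherwise a pendant edge adds a sixth vertex at no cost.
  · by_cases h5 : Fintype.card V ≤ 5
    · obtain ⟨S', c', h6, h7⟩ := hear 2 0 (by omega) (by omega) h4
      obtain rfl := (card_eq_iff_eq_univ S').1 (le_antisymm S'.card_le_univ (by omega))
      exact ⟨c', 3, by omega, by rw [card_univ] at h6; omega, h7⟩
    let f : Fin 5 → V := fun i => p.getVert i
    have hf : Function.Injective f := fun i j hij =>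
      Fin.ext (hpinj i j (by omega) (by omega) hij)
    have hfadj : ∀ i, G.Adj (f i) (f (i + 1)) := by
      intro i
      by_cases hi : i = 4
      · subst hi
        have h6 : f 4 = v := by
          change p.getVert 4 = v
          rw [← h4, p.getVert_length]
        have h7 : f (4 + 1) = u := p.getVert_zero
        rw [h6, h7]
        exact huv.symm
      · have h6 : (i + 1).val = i.val + 1 := by
          revert i
          decide
        change G.Adj (p.getVert i) (p.getVert (i + 1).val)
        rw [h6]
        exact p.adj_getVert_succ (by omega)
    obtain ⟨s, hs⟩ := hother (univ.image f) (by rw [card_image_of_injective _ hf]; simp; omega)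
    have hs' : s ∉ Set.range f := by simpa using hs
    have hs0 : s ≠ f 0 := fun h => hs' ⟨0, h.symm⟩
    have hf10 : f 1 ≠ f 0 := hf.ne (by decide)
    obtain ⟨_, ⟨j, rfl⟩, w, hw, hjw, -⟩ := hG.exists_adj_of_mem_of_notMem
      (C := Set.range f) ⟨1, rfl⟩ hs' (f 0) (f 0) hf10 hf10 hs0 hs0
    obtain ⟨S, c, h6, h7⟩ := exists_rainbowOn_cycle_pendant hf hfadj (w := w)
      (fun i h => hw ⟨i, h.symm⟩) hjw.symm
    exact h7.exists_univ_of_isVertexConnected hG (by omega) (by omega) (by omega)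
  · obtain ⟨S', c', h6, h7⟩ := hear (p.length / 2) (p.length % 2) (by omega) (by omega)
      (by omega)
    exact h7.exists_univ_of_isVertexConnected hG (by omega) (by omega) (by omega)

end SimpleGraph

theorem theorem1 {V : Type*} [Fintype V] (G : SimpleGraph V) (hG : G.IsVertexConnected 3) :
    (G.rainbowConnectionNumber : ℝ) ≤ 3 * ((Fintype.card V : ℝ) + 1) / 5 := by
  obtain ⟨c, k, hk, hkn, h⟩ := hG.exists_rainbowOn_univ
  have h1 : (G.rainbowConnectionNumber : ℝ) ≤ k := by
    exact_mod_cast h.rainbowConnectionNumber_le hk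
  have h2 : (5 * k : ℝ) ≤ 3 * Fintype.card V + 3 := by exact_mod_cast hkn
  linarith
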